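/- A commutative ring $A$ with unity is a pm-ring if every prime ideal of $A$ is contained in a unique maximal ideal; let $\mu:\mathrm{Spec}(A)\to\mathrm{Max}(A)$ be the (continuous) map sending a prime ideal to the unique maximal ideal containing it, where both spectra carry the Zariski topology. Let $k\in\{\mathbb{Z},\mathbb{R}\}$ and let $A$ be a pm-ring equipped with a $k$-algebra structure. For a unital $k$-algebra endomorphism $f$ of $A$ put $\mu_f:\mathrm{Max}(A)\to\mathrm{Max}(A)$, $\mu_f(M)=\mu(f^{-1}(M))$. Let $X_k^A=\{\mu_f : f\in\mathrm{End}_{k\text{-alg}}(A)\}$, with the subspace topology from the space $C(\mathrm{Max}(A),\mathrm{Max}(A))$ of continuous maps with the compact-open topology, and let $\pi_k^{alg}(A)=\pi_1(X_k^A,\mu_{id_A})$ be the spectral fundamental group of $A$. Let $S^1$ be the unit circle and let $A=C(S^1)$ be the ring of continuous real-valued functions on $S^1$ (a pm-ring), with its usual $k$-algebra structure. Then for both $k=\mathbb{Z}$ and $k=\mathbb{R}$ there are group isomorphisms $$\pi_k^{alg}(C(S^1))\;\cong\;\pi_1\bigl(C(S^1,S^1),\,id_{S^1}\bigr)\;\cong\;\mathbb{Z},$$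 where $C(S^1,S^1)$ carries the compact-open topology. In particular, $\pi_k^{alg}(C(S^1))$ is nontrivial. -/

import Mathlib

/-- A commutative ring is a pm-ring if every prime ideal is contained in a unique maximal ideal. -/
class IsPMRing (A : Type*) [CommRing A] : Prop where
  existsUnique_le : ∀ P : PrimeSpectrum A, ∃! M : MaximalSpectrum A, P.asIdeal ≤ M.asIdeal

section Retraction

variable {A : Type*} [CommRing A]

/-- An algebraic criterion for being a pm-ring. -/
theorem IsPMRing.of_forall_add_eq_one
    (h : ∀ a b : A, a + b = 1 → ∃ r s : A, (1 - a * r) * (1 - b * s) = 0) : IsPMRing A := by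
  refine ⟨fun P => ?_⟩
  obtain ⟨M, hM, hPM⟩ := P.asIdeal.exists_le_maximal P.isPrime.ne_top
  refine ⟨⟨M, hM⟩, hPM, fun N hPN => ?_⟩
  by_contra hne
  have hne' : M ≠ N.asIdeal := fun e => hne (by ext1; exact e.symm)
  have hsup : M ⊔ N.asIdeal = ⊤ := hM.coprime_of_ne N.isMaximal hne'
  obtain ⟨a, ha, b, hb, hab⟩ := Submodule.mem_sup.1 ((Ideal.eq_top_iff_one _).1 hsup)
  obtain ⟨r, s, hrs⟩ := h a b hab
  have hz : (1 - a * r) * (1 - b * s) ∈ P.asIdeal := by rw [hrs]; exact zero_mem _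
  rcases P.isPrime.mem_or_mem hz with h1 | h1
  · refine hM.ne_top ((Ideal.eq_top_iff_one _).2 ?_)
    have := add_mem (hPM h1) (M.mul_mem_right r ha)
    simpa using this
  · refine N.isMaximal.ne_top ((Ideal.eq_top_iff_one _).2 ?_)
    have := add_mem (hPN h1) (N.asIdeal.mul_mem_right s hb)
    simpa using this

/-- The map `μ : Spec A → Max A` sending a prime ideal of a pm-ring to the unique maximal ideal
containing it. -/
noncomputable def pmRetraction (A : Type*) [CommRing A] [IsPMRing A] (P : PrimeSpectrum A) :
    MaximalSpectrum A :=
  (IsPMRing.existsUnique_le P).choose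

variable [IsPMRing A]

theorem le_pmRetraction (P : PrimeSpectrum A) : P.asIdeal ≤ (pmRetraction A P).asIdeal :=
  (IsPMRing.existsUnique_le P).choose_spec.1

theorem eq_pmRetraction {P : PrimeSpectrum A} {M : MaximalSpectrum A}
    (h : P.asIdeal ≤ M.asIdeal) : M = pmRetraction A P :=
  (IsPMRing.existsUnique_le P).choose_spec.2 M h

theorem pmRetraction_toPrimeSpectrum (M : MaximalSpectrum A) :
    pmRetraction A M.toPrimeSpectrum = M :=
  (eq_pmRetraction (P := M.toPrimeSpectrum) le_rfl).symm

theorem continuous_pmRetraction : Continuous (pmRetraction A) := by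
  refine continuous_iff_isClosed.2 fun F hF => ?_
  obtain ⟨Z, hZ, rfl⟩ := isClosed_induced_iff.1 hF
  obtain ⟨I, rfl⟩ := (PrimeSpectrum.isClosed_iff_zeroLocus_ideal Z).1 hZ
  let S : Submonoid A :=
    { carrier := {x | ∃ i ∈ I, x = 1 + i}
      one_mem' := ⟨0, zero_mem _, by simp⟩
      mul_mem' := by
        rintro _ _ ⟨i, hi, rfl⟩ ⟨j, hj, rfl⟩
        exact ⟨i + j + i * j, add_mem (add_mem hi hj) (I.mul_mem_right _ hi), by ring⟩ }
  have key : pmRetraction A ⁻¹' (MaximalSpectrum.toPrimeSpectrum ⁻¹'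
      PrimeSpectrum.zeroLocus (I : Set A)) =
      Set.range (PrimeSpectrum.comap (algebraMap A (Localization S))) := by
    rw [PrimeSpectrum.localization_comap_range (Localization S) S]
    ext P
    simp only [Set.mem_preimage, PrimeSpectrum.mem_zeroLocus, SetLike.coe_subset_coe,
      Set.mem_ofPred_eq]
    constructor
    · intro h
      rw [Set.disjoint_left]
      rintro _ ⟨i, hi, rfl⟩ hP
      refine (pmRetraction A P).isMaximal.ne_top ((Ideal.eq_top_iff_one _).2 ?_)
      have := sub_mem (le_pmRetraction P hP) (h hi)
      simpa using this
    · intro h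
      have hne : P.asIdeal ⊔ I ≠ ⊤ := by
        intro htop
        obtain ⟨p, hp, i, hi, hpi⟩ := Submodule.mem_sup.1 ((Ideal.eq_top_iff_one _).1 htop)
        have hpS : p ∈ (S : Set A) := ⟨-i, neg_mem hi, by rw [← hpi]; ring⟩
        exact (Set.disjoint_left.1 h hpS) hp
      obtain ⟨M, hM, hle⟩ := Ideal.exists_le_maximal _ hne
      have e := eq_pmRetraction (P := P) (M := ⟨M, hM⟩) (le_sup_left.trans hle)
      rw [← e]
      exact le_sup_right.trans hle
  rw [key]
  refine PrimeSpectrum.isClosed_range_of_stableUnderSpecialization _ ?_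
  rw [← key]
  intro P Q hPQ hP
  have hle : P.asIdeal ≤ Q.asIdeal := (PrimeSpectrum.le_iff_specializes P Q).2 hPQ
  have e : pmRetraction A Q = pmRetraction A P :=
    eq_pmRetraction (hle.trans (le_pmRetraction Q))
  simpa only [Set.mem_preimage, e] using hP

end Retraction

section SpectralFundamentalGroup

/-- The induced spectral map `μ_f = μ ∘ f_*|_{Max A}` of a `k`-algebra endomorphism `f` of a
pm-ring `A`, where `f_*(P) = f⁻¹(P)`. -/
noncomputable def inducedSpectralMap {k A : Type*} [CommRing k] [CommRing A] [IsPMRing A]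
    [Algebra k A] (f : A →ₐ[k] A) : C(MaximalSpectrum A, MaximalSpectrum A) where
  toFun M := pmRetraction A (PrimeSpectrum.comap (f : A →+* A) M.toPrimeSpectrum)
  continuous_toFun := continuous_pmRetraction.comp
    ((PrimeSpectrum.continuous_comap (f : A →+* A)).comp
      MaximalSpectrum.toPrimeSpectrum_continuous)

/-- The set `X_k^A` of all induced spectral maps; as a subtype it carries the subspace topology
of the compact-open topology on `C(Max A, Max A)`. -/
def inducedSpectralMaps (k A : Type*) [CommRing k] [CommRing A] [IsPMRing A] [Algebra k A] :
    Set C(MaximalSpectrum A, MaximalSpectrum A) :=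
  Set.range (inducedSpectralMap : (A →ₐ[k] A) → C(MaximalSpectrum A, MaximalSpectrum A))

/-- The base point `μ_{id}` of `X_k^A`. -/
noncomputable def inducedSpectralMapId (k A : Type*) [CommRing k] [CommRing A] [IsPMRing A]
    [Algebra k A] : inducedSpectralMaps k A :=
  ⟨inducedSpectralMap (AlgHom.id k A), AlgHom.id k A, rfl⟩

/-- The spectral fundamental group `π_k^{alg}(A) = π₁(X_k^A, μ_{id})`. -/
abbrev SpectralFundamentalGroup (k A : Type*) [CommRing k] [CommRing A] [IsPMRing A]
    [Algebra k A] : Type _ :=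
  FundamentalGroup (inducedSpectralMaps k A) (inducedSpectralMapId k A)

end SpectralFundamentalGroup

/-- The ring of real-valued continuous functions on a topological space is a pm-ring. -/
instance ContinuousMap.instIsPMRing (X : Type*) [TopologicalSpace X] : IsPMRing C(X, ℝ) := by
  refine IsPMRing.of_forall_add_eq_one fun a b hab => ?_
  have hpos : ∀ t : ℝ, max t (1 / 2) ≠ 0 := fun t =>
    ne_of_gt (lt_of_lt_of_le (by norm_num) (le_max_right t (1 / 2)))
  refine ⟨⟨fun x => (max (a x) (1 / 2))⁻¹, ?_⟩, ⟨fun x => (max (b x) (1 / 2))⁻¹, ?_⟩, ?_⟩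
  · exact (a.continuous.max continuous_const).inv₀ fun x => hpos _
  · exact (b.continuous.max continuous_const).inv₀ fun x => hpos _
  · ext x
    have hx : a x + b x = 1 := by simpa using DFunLike.congr_fun hab x
    simp only [ContinuousMap.mul_apply, ContinuousMap.sub_apply, ContinuousMap.one_apply,
      ContinuousMap.coe_mk, ContinuousMap.zero_apply]
    rcases le_total (1 / 2) (a x) with h | h
    · have := hpos (a x)
      rw [max_eq_left h] at this ⊢
      rw [mul_inv_cancel₀ this]; simp
    · have h' : 1 / 2 ≤ b x := by linarith
      have := hpos (b x)
      rw [max_eq_left h'] at this ⊢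
      rw [mul_inv_cancel₀ this]; simp

/-!
The argument has two independent halves.

*Algebra to topology.* For a compact Hausdorff space `X`, the map `x ↦ {a | a x = 0}` is a
homeomorphism from `X` to the maximal spectrum of `C(X, ℝ)`
(`ContinuousMap.homeomorphMaximalSpectrum`). Composition with a continuous map `φ : X → X` is an
endomorphism of `C(X, ℝ)`, and the spectral map it induces is `φ` under this homeomorphism
(`inducedSpectralMap_maximalIdealAt`). So every continuous self-map of the maximal spectrum is
induced (`inducedSpectralMaps_eq_univ`); no classification of the ring endomorphisms is needed,
and the base ring is irrelevant as long as composition is linear over it. Hence the spectral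
fundamental group is the fundamental group of `C(X, X)` at the identity
(`spectralFundamentalGroupEquiv`).

*Mapping spaces into the circle.* For a connected locally compact space `X`, evaluation at a point
`x₀` induces an isomorphism from the fundamental group of `C(X, Circle)` at any `φ` to that of the
circle (`ContinuousMap.fundamentalGroupEquivEval`). It is onto because rotating `φ` gives a section
of the evaluation, and it is injective because a loop based at `φ`, divided by `φ`, lifts through
`Circle.exp` to a family of real-valued functions, which closes up as soon as it does so at `x₀`
(`Path.homotopic_refl_of_eval`). The fundamental group of the circle is the deck group of
`Circle.exp`, an infinite cyclic group (`Circle.fundamentalGroupEquivInt`).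
-/

/-! ### Functoriality of the fundamental group -/

namespace FundamentalGroup

variable {X Y Z : Type*} [TopologicalSpace X] [TopologicalSpace Y] [TopologicalSpace Z]

theorem mapOfEq_comp_apply (f : C(X, Y)) (g : C(Y, Z)) {x : X} {y : Y} {z : Z} (hf : f x = y)
    (hg : g y = z) (p : FundamentalGroup X x) :
    mapOfEq g hg (mapOfEq f hf p) = mapOfEq (g.comp f) (by simp [hf, hg]) p := by
  subst hf hg
  simp only [mapOfEq_apply]
  induction p using Path.Homotopic.Quotient.ind with | mk γ => rfl

theorem mapOfEq_apply_of_eq_id (f : C(X, X)) (hf : f = ContinuousMap.id X) {x : X} (hx : f x = x)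
    (p : FundamentalGroup X x) : mapOfEq f hx p = p := by
  subst hf
  simp only [mapOfEq_apply]
  induction p using Path.Homotopic.Quotient.ind with | mk γ => rfl

/-- The isomorphism of fundamental groups induced by a homeomorphism. -/
noncomputable def congrHomeomorph (h : X ≃ₜ Y) {x : X} {y : Y} (hxy : h x = y) :
    FundamentalGroup X x ≃* FundamentalGroup Y y :=
  (mapOfEq (h : C(X, Y)) hxy).toMulEquiv
    (mapOfEq (h.symm : C(Y, X)) (h.symm_apply_eq.2 hxy.symm))
    (MonoidHom.ext fun p => by
      simp only [MonoidHom.comp_apply, mapOfEq_comp_apply, MonoidHom.id_apply]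
      exact mapOfEq_apply_of_eq_id _ (by ext; simp) _ _)
    (MonoidHom.ext fun p => by
      simp only [MonoidHom.comp_apply, mapOfEq_comp_apply, MonoidHom.id_apply]
      exact mapOfEq_apply_of_eq_id _ (by ext; simp) _ _)

end FundamentalGroup

/-! ### The fundamental group of the circle -/

/-- The fundamental group of the circle is the deck group `2πℤ` of the covering
`Circle.exp : ℝ → Circle`. -/
noncomputable def Circle.fundamentalGroupEquivInt (z : Circle) :
    FundamentalGroup Circle z ≃* Multiplicative ℤ :=
  (Circle.isAddQuotientCoveringMap_exp.fundamentalGroupEquiv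
      ⟨Complex.arg z, Circle.exp_arg z⟩).trans <|
    (MulOpposite.opMulEquiv (M := Multiplicative (AddSubgroup.zmultiples (2 * Real.pi)))).symm.trans
      (AddEquiv.toMultiplicative <|
        ((AddMonoidHom.ofInjective (f := zmultiplesHom ℝ (2 * Real.pi)) fun m n h =>
          by simpa [Real.pi_ne_zero] using h).trans
        (AddEquiv.addSubgroupCongr (AddSubgroup.range_zmultiplesHom _))).symm)

/-! ### Evaluation on mapping spaces into the circle -/

section Evaluation

open scoped unitInterval

variable {X : Type*} [TopologicalSpace X]

/-- A loop in `C(X, Circle)` whose evaluation at one point of the connected space `X` is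
null-homotopic is itself null-homotopic: divided by its base point it lifts to a family of
real-valued functions starting at `0`; the end of the family takes values in the discrete fibre
`2πℤ` and vanishes at `x₀`, hence is `0`, and the lift can be contracted linearly. -/
theorem Path.homotopic_refl_of_eval [LocallyCompactSpace X] [PreconnectedSpace X]
    {φ : C(X, Circle)} (γ : Path φ φ) (x₀ : X)
    (h : (γ.map (continuous_eval_const x₀)).Homotopic (Path.refl (φ x₀))) :
    γ.Homotopic (Path.refl φ) := by
  have cov := Circle.isCoveringMap_exp
  let γ' : C(I × X, Circle) := ContinuousMap.uncurry ⟨γ, γ.continuous⟩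
  let H : C(I × X, Circle) := ⟨fun p => γ' p / φ p.2, by fun_prop⟩
  have H_0 : ∀ x, H (0, x) = Circle.exp ((0 : C(X, ℝ)) x) := fun x => by simp [H, γ']
  let L := cov.liftHomotopy H 0 H_0
  have L_lifts : ∀ t x, Circle.exp (L (t, x)) = γ t x / φ x := fun t x =>
    congr_fun (cov.liftHomotopy_lifts H 0 H_0) (t, x)
  have L_zero : ∀ x, L (0, x) = 0 := cov.liftHomotopy_zero H 0 H_0
  -- The lift along `x₀` closes up because the evaluated loop is null-homotopic.
  have L_one_x₀ : L (1, x₀) = 0 := by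
    have hrel : (H.comp ((ContinuousMap.id I).prodMk (.const I x₀))).HomotopicRel
        (.const I 1) {0, 1} := by
      let d : C(Circle, Circle) := ⟨fun w => w / φ x₀, by fun_prop⟩
      have hd : ContinuousMap.const I 1 = ((Path.refl (φ x₀)).map d.continuous).toContinuousMap :=
        ContinuousMap.ext fun t => (div_self' (φ x₀)).symm
      rw [hd]
      exact h.map d
    have := cov.liftPath_apply_one_eq_of_homotopicRel hrel 0 (by simp [H, γ']) (by simp)
    rwa [cov.liftPath_const] at this
  have L_one : ∀ x, L (1, x) = 0 := by
    have := cov.eq_of_comp_eq (g₁ := fun x => L (1, x)) (g₂ := fun _ : X => (0 : ℝ))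
      (by fun_prop) continuous_const (by ext x; simp [L_lifts]) x₀ L_one_x₀
    exact congr_fun this
  refine ⟨⟨⟨⟨fun p => ⟨fun x => Circle.exp ((1 - p.1 : ℝ) * L (p.2, x)) * φ x, by fun_prop⟩, ?_⟩,
    ?_, ?_⟩, ?_⟩⟩
  · refine ContinuousMap.continuous_of_continuous_uncurry _ ?_
    dsimp [Function.uncurry]
    fun_prop
  · intro t; ext x; simp [L_lifts]
  · intro t; ext x; simp
  · rintro t p (rfl | rfl)
    · ext x; simp [L_zero]
    · ext x; simp [L_one]

variable (φ : C(X, Circle)) (x₀ : X)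

/-- Surjectivity holds because the rotations `w / φ x₀ * φ` of `φ`, for `w` in the circle, form a
continuous section of the evaluation at `x₀`, which sends `φ x₀` to `φ`. -/
theorem ContinuousMap.mapOfEq_eval_bijective [LocallyCompactSpace X] [PreconnectedSpace X] :
    Function.Bijective (FundamentalGroup.mapOfEq (x := φ) (y := φ x₀)
      (⟨fun f : C(X, Circle) => f x₀, continuous_eval_const x₀⟩) rfl) := by
  constructor
  · rw [injective_iff_map_eq_one]
    intro p hp
    induction p using Path.Homotopic.Quotient.ind with | mk γ =>
    rw [FundamentalGroup.mapOfEq_apply] at hp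
    exact Path.Homotopic.Quotient.eq.2
      (Path.homotopic_refl_of_eval γ x₀ (Path.Homotopic.Quotient.eq.1 hp))
  · intro p
    let s : C(Circle, C(X, Circle)) :=
      ⟨fun w => ⟨fun x => w / φ x₀ * φ x, by fun_prop⟩,
        ContinuousMap.continuous_of_continuous_uncurry _ (by dsimp [Function.uncurry]; fun_prop)⟩
    have hs : s (φ x₀) = φ := by ext x; simp [s]
    refine ⟨FundamentalGroup.mapOfEq s hs p, ?_⟩
    rw [FundamentalGroup.mapOfEq_comp_apply]
    exact FundamentalGroup.mapOfEq_apply_of_eq_id _ (by ext w; simp [s]) _ _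

/-- Evaluation at a point identifies the fundamental group of the space of maps from a connected
locally compact space to the circle with the fundamental group of the circle. -/
noncomputable def ContinuousMap.fundamentalGroupEquivEval [LocallyCompactSpace X]
    [PreconnectedSpace X] :
    FundamentalGroup C(X, Circle) φ ≃* FundamentalGroup Circle (φ x₀) :=
  MulEquiv.ofBijective _ (ContinuousMap.mapOfEq_eval_bijective φ x₀)

end Evaluation

/-! ### The maximal spectrum of a ring of continuous functions -/

section MaximalSpectrum

variable {X : Type*} [TopologicalSpace X] [CompactSpace X] [T2Space X]

/-- The maximal ideal of functions vanishing at a point. -/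
def ContinuousMap.maximalIdealAt (x : X) : MaximalSpectrum C(X, ℝ) :=
  ⟨ContinuousMap.idealOfSet ℝ {x}ᶜ, ContinuousMap.idealOf_compl_singleton_isMaximal ℝ x⟩

@[simp]
theorem ContinuousMap.mem_maximalIdealAt {x : X} {f : C(X, ℝ)} :
    f ∈ (ContinuousMap.maximalIdealAt x).asIdeal ↔ f x = 0 :=
  ContinuousMap.mem_idealOfSet_compl_singleton x f

theorem ContinuousMap.maximalIdealAt_bijective :
    Function.Bijective (ContinuousMap.maximalIdealAt : X → MaximalSpectrum C(X, ℝ)) := by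
  refine ⟨fun x y hxy => ?_, fun M => ?_⟩
  · have : ContinuousMap.setOfIdeal (ContinuousMap.maximalIdealAt x).asIdeal =
      ContinuousMap.setOfIdeal (ContinuousMap.maximalIdealAt y).asIdeal := by rw [hxy]
    simpa [maximalIdealAt, ContinuousMap.setOfIdeal_ofSet_of_isOpen] using this
  · have := M.isMaximal
    obtain ⟨x, hx⟩ := (ContinuousMap.ideal_isMaximal_iff M.asIdeal).1 M.isMaximal
    exact ⟨x, MaximalSpectrum.ext hx⟩

theorem ContinuousMap.continuous_maximalIdealAt :
    Continuous (ContinuousMap.maximalIdealAt : X → MaximalSpectrum C(X, ℝ)) := by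
  refine continuous_induced_rng.2 (continuous_iff_isClosed.2 fun Z hZ => ?_)
  obtain ⟨s, rfl⟩ := (PrimeSpectrum.isClosed_iff_zeroLocus Z).1 hZ
  have : MaximalSpectrum.toPrimeSpectrum ∘ ContinuousMap.maximalIdealAt ⁻¹'
      PrimeSpectrum.zeroLocus s = ⋂ f ∈ s, {x : X | f x = 0} := by
    ext x
    simp only [Set.mem_preimage, PrimeSpectrum.mem_zeroLocus, Set.mem_iInter]
    exact forall₂_congr fun f _ => ContinuousMap.mem_maximalIdealAt
  rw [this]
  exact isClosed_biInter fun f _ => isClosed_eq f.continuous continuous_const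

/-- The image of a closed set `C` is the zero locus of the ideal of functions vanishing on `C`, since
by Urysohn's lemma these functions have no common zero outside `C`. -/
theorem ContinuousMap.isClosedMap_maximalIdealAt :
    IsClosedMap (ContinuousMap.maximalIdealAt : X → MaximalSpectrum C(X, ℝ)) := by
  intro C hC
  refine isClosed_induced_iff.2
    ⟨_, PrimeSpectrum.isClosed_zeroLocus (ContinuousMap.idealOfSet ℝ Cᶜ : Set C(X, ℝ)), ?_⟩
  ext M
  obtain ⟨x, rfl⟩ := ContinuousMap.maximalIdealAt_bijective.surjective M
  rw [ContinuousMap.maximalIdealAt_bijective.injective.mem_set_image, Set.mem_preimage,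
    PrimeSpectrum.mem_zeroLocus, ← not_iff_not, ← Set.mem_compl_iff,
    ← ContinuousMap.setOfIdeal_ofSet_of_isOpen ℝ hC.isOpen_compl, ContinuousMap.mem_setOfIdeal,
    Set.not_subset, ContinuousMap.setOfIdeal_ofSet_of_isOpen ℝ hC.isOpen_compl]
  exact exists_congr fun f => and_congr_right fun _ =>
    not_congr ContinuousMap.mem_maximalIdealAt

variable (X) in
/-- A compact Hausdorff space is homeomorphic to the maximal spectrum of its ring of real-valued
continuous functions. -/
noncomputable def ContinuousMap.homeomorphMaximalSpectrum : X ≃ₜ MaximalSpectrum C(X, ℝ) :=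
  (Equiv.ofBijective _ ContinuousMap.maximalIdealAt_bijective).toHomeomorphOfContinuousClosed
    ContinuousMap.continuous_maximalIdealAt ContinuousMap.isClosedMap_maximalIdealAt

/-! ### The space of induced spectral maps -/

variable {k : Type*} [CommRing k]

/-- An endomorphism of `C(X, ℝ)` given by composition with `φ : X → X` induces `φ` on the maximal
spectrum. -/
theorem inducedSpectralMap_maximalIdealAt [Algebra k C(X, ℝ)] {φ : C(X, X)}
    {f : C(X, ℝ) →ₐ[k] C(X, ℝ)} (hf : ∀ a, f a = a.comp φ) (x : X) :
    inducedSpectralMap f (ContinuousMap.maximalIdealAt x) =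
      ContinuousMap.maximalIdealAt (φ x) := by
  refine (eq_pmRetraction fun a ha => ?_).symm
  have ha' : f a ∈ (ContinuousMap.maximalIdealAt x).asIdeal := ha
  rw [ContinuousMap.mem_maximalIdealAt, hf] at ha'
  exact ContinuousMap.mem_maximalIdealAt.2 ha'

variable [Algebra k ℝ]

/-- Every continuous self-map of the maximal spectrum is induced: transported to `X`, it is the map
induced by composition with itself. -/
theorem inducedSpectralMaps_eq_univ : inducedSpectralMaps k C(X, ℝ) = Set.univ := by
  refine Set.eq_univ_of_forall fun g => ?_
  let e := ContinuousMap.homeomorphMaximalSpectrum X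
  let φ : C(X, X) := (e.symm : C(MaximalSpectrum C(X, ℝ), X)).comp (g.comp (e : C(X, _)))
  refine ⟨ContinuousMap.compRightAlgHom k ℝ φ, ContinuousMap.ext fun M => ?_⟩
  obtain ⟨x, rfl⟩ := e.surjective M
  exact (inducedSpectralMap_maximalIdealAt (fun _ => rfl) x).trans (e.apply_symm_apply _)

variable (X k) in
/-- The space of induced spectral maps of `C(X, ℝ)` is the space of continuous self-maps of `X`, by
conjugation with the homeomorphism of `X` with the maximal spectrum. -/
noncomputable def inducedSpectralMapsHomeomorph : inducedSpectralMaps k C(X, ℝ) ≃ₜ C(X, X) :=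
  (Homeomorph.setCongr inducedSpectralMaps_eq_univ).trans <|
    (Homeomorph.Set.univ _).trans <|
      (ContinuousMap.homeomorphMaximalSpectrum X).symm.arrowCongr
        (ContinuousMap.homeomorphMaximalSpectrum X).symm

theorem inducedSpectralMapsHomeomorph_id :
    inducedSpectralMapsHomeomorph X k (inducedSpectralMapId k C(X, ℝ)) = ContinuousMap.id X := by
  ext x
  refine (ContinuousMap.homeomorphMaximalSpectrum X).symm_apply_eq.2 ?_
  exact inducedSpectralMap_maximalIdealAt (φ := ContinuousMap.id X) (fun _ => rfl) x

variable (X k) in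
/-- The spectral fundamental group of `C(X, ℝ)` is the fundamental group of the space of
continuous self-maps of `X`. -/
noncomputable def spectralFundamentalGroupEquiv :
    SpectralFundamentalGroup k C(X, ℝ) ≃* FundamentalGroup C(X, X) (ContinuousMap.id X) :=
  FundamentalGroup.congrHomeomorph (inducedSpectralMapsHomeomorph X k)
    inducedSpectralMapsHomeomorph_id

end MaximalSpectrum

/-! ### The spectral fundamental group of `C(Circle, ℝ)` -/

theorem mainTheorem10 :
    Nonempty (SpectralFundamentalGroup ℤ C(Circle, ℝ) ≃*
        FundamentalGroup C(Circle, Circle) (ContinuousMap.id Circle)) ∧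
      Nonempty (SpectralFundamentalGroup ℝ C(Circle, ℝ) ≃*
        FundamentalGroup C(Circle, Circle) (ContinuousMap.id Circle)) ∧
      Nonempty (FundamentalGroup C(Circle, Circle) (ContinuousMap.id Circle) ≃*
        Multiplicative ℤ) ∧
      Nonempty (SpectralFundamentalGroup ℤ C(Circle, ℝ) ≃* Multiplicative ℤ) ∧
      Nonempty (SpectralFundamentalGroup ℝ C(Circle, ℝ) ≃* Multiplicative ℤ) ∧
      Nontrivial (SpectralFundamentalGroup ℤ C(Circle, ℝ)) ∧
      Nontrivial (SpectralFundamentalGroup ℝ C(Circle, ℝ)) := by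
  have eZ := spectralFundamentalGroupEquiv Circle ℤ
  have eR := spectralFundamentalGroupEquiv Circle ℝ
  have e := (ContinuousMap.fundamentalGroupEquivEval (ContinuousMap.id Circle) 1).trans
    (Circle.fundamentalGroupEquivInt _)
  exact ⟨⟨eZ⟩, ⟨eR⟩, ⟨e⟩, ⟨eZ.trans e⟩, ⟨eR.trans e⟩, (eZ.trans e).toEquiv.nontrivial,
    (eR.trans e).toEquiv.nontrivial⟩
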